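/- Consider $n$ processes that are deterministic automata, communicate by broadcasting, and follow full-information protocols: every process always broadcasts its view, i.e. its initial state (identity and input value) followed by its complete local history. A process may decide on an output value as a function of its view, at most once; the output is $\bot$ if it never decides. A task is $T=(\mathcal I,\mathcal O,\Delta)$, where $\mathcal I$ is a set of input vectors (one value per process), $\mathcal O$ is a set of output vectors (entries may be $\bot$), and $\Delta\subseteq\mathcal I\times\mathcal O$ relates every $I\in\mathcal I$ to at least one $O\in\mathcal O$ and is closed under replacing entries of $O$ by $\bot$. A protocol solves $T$ in a model $\mathcal M$ if in every run of the protocol in $\mathcal M$ with input vector $I\in\mathcal I$ the output vector $O$ satisfies $(I,O)\in\Delta$, and $O[i]=\bot$ only if process $i$ is faulty in that run. $T$ is solvable in $\mathcal M$ if some protocol solves it in $\mathcal M$. $\mathrm{HO}_f$ (Heard-Of model with $f$ message omissions): computation proceeds in rounds $0,1,2,\dots$; in each round every process broadcasts its view and then receives the messages sent in this round by a set of processes that contains itself and misses at most $f$ processes (the set may depend on the process and on the round). Missed messages are lost. No process is faulty. $\mathrm{AMP}_f$ (asynchronous message passing with $f$ failures): a run is a finite or infinite sequence of atomic steps; in a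 step one process receives at most one message, updates its view, and broadcasts the new view to all processes including itself. A process is faulty if it takes only finitely many steps; at most $f$ processes are faulty. Every received message was sent earlier, and no message is received more than once by the same process. Every message sent by a non-faulty process is received by all non-faulty processes, and every message sent by a faulty process, except possibly its last one, is received by all non-faulty processes. Lemma. Let $0\le f\le n$. Every task for $n$ processes that is solvable in $\mathrm{HO}_f$ is solvable in $\mathrm{AMP}_f$. -/

import Mathlib

namespace TaskSolvability

universe u v

/-- A message-passing model for `n` processes running full-information protocols with inputs in `α`.
It fixes the possible local histories (views) of a process, the schedules, the processes that are
faulty under a schedule, and the local states in the run determined by a schedule and an initial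
configuration. A full-information process always broadcasts its view, so a run depends only on the
schedule and the input vector. -/
structure Model (n : ℕ) (α : Type u) where
  /-- local histories of a process -/
  View : Type u
  /-- `Next v w`: the history `w` is `v` followed by one more local step -/
  Next : View → View → Prop
  Schedule : Type
  /-- the schedules allowed by the model -/
  Admissible : Schedule → Prop
  Faulty : Schedule → Fin n → Prop
  /-- `view S x t i` is the view of process `i` in the `t`-th configuration of the run with
  input vector `x` and schedule `S` -/
  view : Schedule → (Fin n → α) → ℕ → Fin n → View
  view_succ : ∀ S x t i,
    view S x (t + 1) i = view S x t i ∨ Next (view S x t i) (view S x (t + 1) i)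

/-- A full-information protocol: for every process, a rule that tells from its view whether the
process has decided and on which value. A process decides at most once: a decision is never
changed or withdrawn. -/
structure Protocol {n : ℕ} {α : Type u} (M : Model n α) (β : Type v) where
  decide : Fin n → M.View → Option β
  decide_next : ∀ i v w o, M.Next v w → decide i v = some o → decide i w = some o

open Classical in
/-- The output of process `i` in a run: the value it decides on, `none` (that is, `⊥`) if it
never decides. -/
noncomputable def Protocol.output {n : ℕ} {α : Type u} {M : Model n α} {β : Type v}
    (P : Protocol M β) (S : M.Schedule) (x : Fin n → α) (i : Fin n) : Option β :=
  if h : ∃ o t, P.decide i (M.view S x t i) = some o then some h.choose else none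

theorem Protocol.decide_mono {n : ℕ} {α : Type u} {M : Model n α} {β : Type v}
    (P : Protocol M β) (S : M.Schedule) (x : Fin n → α) (i : Fin n) (o : β) {t t' : ℕ}
    (htt : t ≤ t') (h : P.decide i (M.view S x t i) = some o) :
    P.decide i (M.view S x t' i) = some o := by
  induction t', htt using Nat.le_induction with
  | base => exact h
  | succ k _ ih =>
    rcases M.view_succ S x k i with hk | hk
    · rw [hk]; exact ih
    · exact P.decide_next i _ _ o hk ih

theorem Protocol.output_eq_some_iff {n : ℕ} {α : Type u} {M : Model n α} {β : Type v}
    (P : Protocol M β) (S : M.Schedule) (x : Fin n → α) (i : Fin n) (o : β) :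
    P.output S x i = some o ↔ ∃ t, P.decide i (M.view S x t i) = some o := by
  unfold Protocol.output
  constructor
  · intro h
    split_ifs at h with hex
    obtain ⟨t, ht⟩ := hex.choose_spec
    exact ⟨t, by rw [ht]; exact h⟩
  · rintro ⟨t, ht⟩
    have hex : ∃ o t, P.decide i (M.view S x t i) = some o := ⟨o, t, ht⟩
    rw [dif_pos hex]
    obtain ⟨s, hs⟩ := hex.choose_spec
    have h1 := P.decide_mono S x i _ (le_max_left s t) hs
    have h2 := P.decide_mono S x i _ (le_max_right s t) ht
    exact h1.symm.trans h2

/-- A task for `n` processes with input values in `α` and output values in `β`; `none` in an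
output vector stands for `⊥` (undecided). -/
structure Task (n : ℕ) (α : Type u) (β : Type v) where
  inputs : Set (Fin n → α)
  outputs : Set (Fin n → Option β)
  rel : (Fin n → α) → (Fin n → Option β) → Prop
  mem_of_rel : ∀ x y, rel x y → x ∈ inputs ∧ y ∈ outputs
  total : ∀ x ∈ inputs, ∃ y, rel x y
  /-- replacing some entries of an allowed output vector by `⊥` gives an allowed output vector -/
  rel_erase : ∀ x y y', rel x y → (∀ i, y' i = y i ∨ y' i = none) → rel x y'

/-- The protocol `P` solves the task `T` in the model `M`. -/
def Protocol.Solves {n : ℕ} {α : Type u} {M : Model n α} {β : Type v}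
    (P : Protocol M β) (T : Task n α β) : Prop :=
  ∀ x ∈ T.inputs, ∀ S : M.Schedule, M.Admissible S →
    T.rel x (P.output S x) ∧ ∀ i, P.output S x i = none → M.Faulty S i

/-- The task `T` is solvable in the model `M`. -/
def Task.Solvable {n : ℕ} {α : Type u} {β : Type v} (T : Task n α β) (M : Model n α) : Prop :=
  ∃ P : Protocol M β, P.Solves T

/-! ### The asynchronous message-passing model -/

/-- Views in the asynchronous model: the initial state, which holds the identity and the input of
the process, followed by the receive events of the process, each of which obtains no message or
one message. Messages are views. -/
inductive AMPView (n : ℕ) (α : Type u) : Type u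
  | start (i : Fin n) (x : α) : AMPView n α
  | recvNone (v : AMPView n α) : AMPView n α
  | recvMsg (v m : AMPView n α) : AMPView n α

/-- The view after a receive event with result `m` (`none` means no message). -/
def AMPView.receive {n : ℕ} {α : Type u} (v : AMPView n α) : Option (AMPView n α) → AMPView n α
  | none => AMPView.recvNone v
  | some m => AMPView.recvMsg v m

/-- A finite or infinite sequence of atomic steps. `step t = some (i, r)`: at time `t` process `i`
takes a step, in which it receives the message that was broadcast at time `s` if `r = some s` and
no message if `r = none`, updates its view, and broadcasts the new view to all processes,
itself included. `step t = none`: nothing happens at time `t`. -/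
structure AMPSchedule (n : ℕ) where
  step : ℕ → Option (Fin n × Option ℕ)

namespace AMPSchedule

variable {n : ℕ}

/-- Process `i` takes a step, and hence broadcasts a message, at time `t`. -/
def StepsAt (S : AMPSchedule n) (i : Fin n) (t : ℕ) : Prop := ∃ r, S.step t = some (i, r)

/-- Process `j` receives at time `t` the message that was broadcast at time `s`. -/
def ReceivesAt (S : AMPSchedule n) (j : Fin n) (t s : ℕ) : Prop := S.step t = some (j, some s)

/-- A process is faulty if it takes only finitely many steps. -/
def Faulty (S : AMPSchedule n) (i : Fin n) : Prop := {t | S.StepsAt i t}.Finite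

/-- The schedules of the asynchronous model with at most `f` faulty processes. -/
structure Admissible (S : AMPSchedule n) (f : ℕ) : Prop where
  faulty_le : {i | S.Faulty i}.ncard ≤ f
  nonfaulty_liveness : ∀ i j, ¬ S.Faulty i → ¬ S.Faulty j →
    ∀ s, S.StepsAt i s → ∃ t, S.ReceivesAt j t s
  /-- only the last message of a faulty process may fail to reach a non-faulty process -/
  faulty_quasi_liveness : ∀ i j, S.Faulty i → ¬ S.Faulty j →
    ∀ s, S.StepsAt i s → (∃ s' > s, S.StepsAt i s') → ∃ t, S.ReceivesAt j t s
  integrity : ∀ j t s, S.ReceivesAt j t s → s < t ∧ ∃ i, S.StepsAt i s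
  no_duplicates : ∀ j t t' s, S.ReceivesAt j t s → S.ReceivesAt j t' s → t = t'

end AMPSchedule

/-- A configuration of the asynchronous system: the views of all processes, and the messages
broadcast so far, indexed by the time of their broadcast. -/
structure AMPConfig (n : ℕ) (α : Type u) where
  view : Fin n → AMPView n α
  sent : ℕ → Option (AMPView n α)

/-- The configuration before time `t` in the run with schedule `S` and input vector `x`. -/
def ampConfig {n : ℕ} {α : Type u} (S : AMPSchedule n) (x : Fin n → α) : ℕ → AMPConfig n α
  | 0 => ⟨fun i => AMPView.start i (x i), fun _ => none⟩
  | t + 1 =>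
    match S.step t with
    | none => ampConfig S x t
    | some (i, r) =>
      let c := ampConfig S x t
      let w := (c.view i).receive (r.bind c.sent)
      ⟨Function.update c.view i w, Function.update c.sent t (some w)⟩

/-- The asynchronous message-passing model with at most `f` process failures. -/
def AMP (n f : ℕ) (α : Type u) : Model n α where
  View := AMPView n α
  Next v w := ∃ m, w = v.receive m
  Schedule := AMPSchedule n
  Admissible S := S.Admissible f
  Faulty S i := S.Faulty i
  view S x t i := (ampConfig S x t).view i
  view_succ := by
    intro S x t i
    rcases h : S.step t with _ | ⟨j, r⟩
    · left; simp [ampConfig, h]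
    · by_cases hij : i = j
      · right
        subst hij
        exact ⟨r.bind (ampConfig S x t).sent, by simp [ampConfig, h]⟩
      · left; simp [ampConfig, h, hij]

/-! ### The Heard-Of model -/

/-- Views in the Heard-Of model: the initial state, which holds the identity and the input of the
process, followed by its rounds; in a round the process obtains the messages (views) of the
processes in a set `H`. -/
inductive HOView (n : ℕ) (α : Type u) : Type u
  | start (i : Fin n) (x : α) : HOView n α
  | round (v : HOView n α) (H : Finset (Fin n)) (m : {j // j ∈ H} → HOView n α) : HOView n α

/-- `heard r i` is the set of processes whose round-`r` messages process `i` receives. -/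
structure HOSchedule (n : ℕ) where
  heard : ℕ → Fin n → Finset (Fin n)

/-- In every round a process hears from itself and misses at most `f` messages. -/
structure HOSchedule.Admissible {n : ℕ} (S : HOSchedule n) (f : ℕ) : Prop where
  self_mem : ∀ r i, i ∈ S.heard r i
  missed_le : ∀ r i, ((S.heard r i)ᶜ).card ≤ f

/-- The view of a process after `r` rounds: in every round all processes broadcast their views,
then each of them receives the messages of the processes that it hears of. -/
def hoView {n : ℕ} {α : Type u} (S : HOSchedule n) (x : Fin n → α) : ℕ → Fin n → HOView n α
  | 0, i => HOView.start i (x i)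
  | r + 1, i => HOView.round (hoView S x r i) (S.heard r i) (fun j => hoView S x r j.1)

/-- The Heard-Of model with at most `f` message omissions per process and round. No process is
faulty. -/
def HO (n f : ℕ) (α : Type u) : Model n α where
  View := HOView n α
  Next v w := ∃ H m, w = HOView.round v H m
  Schedule := HOSchedule n
  Admissible S := S.Admissible f
  Faulty _ _ := False
  view S x r i := hoView S x r i
  view_succ := by
    intro S x r i
    right
    exact ⟨S.heard r i, fun j => hoView S x r j.1, rfl⟩

end TaskSolvability

namespace TaskSolvability

universe u v

variable {n : ℕ} {α : Type u}

/-! ### Runs of the asynchronous model -/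

/-! Each process simulates Heard-Of rounds inside its asynchronous view. It keeps a current Heard-Of
view and a set of known ones, merges the sender's known set on each receipt, and completes a round
once at most `f` processes lack a known view of that round. Safety (`known_simState_eq_hoView`): all
Heard-Of views known anywhere in an asynchronous run belong to one Heard-Of run, whose schedule
`simSchedule` is read off from the rounds actually completed. Liveness
(`exists_le_len_of_nonfaulty`): views of non-faulty processes eventually reach all non-faulty ones
and at most `f` processes are faulty, so no non-faulty process is stuck in a round. Deciding on the
simulated view thus yields the Heard-Of output, except that faulty processes may stop too early to
decide; tasks allow these entries to become `⊥`. -/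

theorem ampConfig_view_cases (S : AMPSchedule n) (x : Fin n → α) (t : ℕ) (i : Fin n) :
    (¬ S.StepsAt i t ∧ (ampConfig S x (t + 1)).view i = (ampConfig S x t).view i) ∨
      ∃ r, S.step t = some (i, r) ∧ (ampConfig S x (t + 1)).view i =
        ((ampConfig S x t).view i).receive (r.bind (ampConfig S x t).sent) := by
  rcases h : S.step t with _ | ⟨j, r⟩
  · left; simp [ampConfig, h, AMPSchedule.StepsAt]
  · by_cases hij : i = j
    · subst hij
      right
      exact ⟨r, rfl, by simp [ampConfig, h]⟩
    · left
      refine ⟨?_, by simp [ampConfig, h, hij]⟩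
      rintro ⟨r', hr'⟩
      rw [h] at hr'
      simp only [Option.some.injEq, Prod.mk.injEq] at hr'
      exact hij hr'.1.symm

/-- A message is its sender's view right after an earlier step. The bound `s < t` is what lets a
strong induction over time be applied to the sender. -/
theorem ampConfig_sent (S : AMPSchedule n) (x : Fin n → α) (t s : ℕ) (m : AMPView n α)
    (h : (ampConfig S x t).sent s = some m) :
    s < t ∧ ∃ i, m = (ampConfig S x (s + 1)).view i := by
  induction t with
  | zero => simp [ampConfig] at h
  | succ t ih =>
    rcases hS : S.step t with _ | ⟨j, r⟩
    · have := ih (by simpa [ampConfig, hS] using h)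
      exact ⟨by omega, this.2⟩
    · by_cases hst : s = t
      · subst hst
        refine ⟨by omega, j, ?_⟩
        simp only [ampConfig, hS, Function.update_self, Option.some.injEq] at h ⊢
        exact h.symm
      · have := ih (by simpa [ampConfig, hS, hst] using h)
        exact ⟨by omega, this.2⟩

theorem ampConfig_sent_of_stepsAt {S : AMPSchedule n} (x : Fin n → α) {i : Fin n} {s : ℕ}
    (h : S.StepsAt i s) {t : ℕ} (hst : s < t) :
    (ampConfig S x t).sent s = some ((ampConfig S x (s + 1)).view i) := by
  induction t, hst using Nat.le_induction with
  | base =>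
    obtain ⟨r, hr⟩ := h
    simp [ampConfig, hr]
  | succ t hst ih =>
    rw [← ih]
    rcases hS : S.step t with _ | ⟨j, r⟩
    · simp [ampConfig, hS]
    · have : s ≠ t := by omega
      simp [ampConfig, hS, this]

/-! ### Simulating Heard-Of rounds from an asynchronous view -/

/-- The process to which a Heard-Of view belongs. -/
def HOView.owner : HOView n α → Fin n
  | start i _ => i
  | round v _ _ => v.owner

/-- The number of rounds recorded in a Heard-Of view. -/
def HOView.len : HOView n α → ℕ
  | start _ _ => 0
  | round v _ _ => v.len + 1

/-- The state of a process that simulates the Heard-Of model: its current simulated view and all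
the simulated views that it knows of. -/
structure SimState (n : ℕ) (α : Type u) where
  cur : HOView n α
  known : Set (HOView n α)

namespace SimState

open Classical in
/-- The processes whose simulated view of the current round is known. -/
noncomputable def heard (s : SimState n α) : Finset (Fin n) :=
  Finset.univ.filter fun j => ∃ w ∈ s.known, w.owner = j ∧ w.len = s.cur.len

theorem mem_heard {s : SimState n α} {j : Fin n} :
    j ∈ s.heard ↔ ∃ w ∈ s.known, w.owner = j ∧ w.len = s.cur.len := by
  simp [heard]

/-- The simulated view of the current round of a heard process. -/
noncomputable def message (s : SimState n α) (j : {j // j ∈ s.heard}) : HOView n α :=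
  -- The choice is harmless: within a run, owner and length determine a known view, by
  -- `known_simState_eq_hoView`.
  (mem_heard.1 j.2).choose

theorem message_spec (s : SimState n α) (j : {j // j ∈ s.heard}) :
    s.message j ∈ s.known ∧ (s.message j).owner = j.1 ∧ (s.message j).len = s.cur.len :=
  (mem_heard.1 j.2).choose_spec

/-- The view after the completion of the current round. -/
noncomputable def nextView (s : SimState n α) : HOView n α :=
  HOView.round s.cur s.heard s.message

/-- Complete the current round if at most `f` messages of that round are missing. -/
noncomputable def advance (f : ℕ) (s : SimState n α) : SimState n α :=
  if s.heardᶜ.card ≤ f then ⟨s.nextView, insert s.nextView s.known⟩ else s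

theorem advance_of_le {f : ℕ} {s : SimState n α} (h : s.heardᶜ.card ≤ f) :
    s.advance f = ⟨s.nextView, insert s.nextView s.known⟩ := if_pos h

theorem advance_of_not_le {f : ℕ} {s : SimState n α} (h : ¬ s.heardᶜ.card ≤ f) :
    s.advance f = s := if_neg h

theorem known_subset_advance (f : ℕ) (s : SimState n α) : s.known ⊆ (s.advance f).known := by
  by_cases h : s.heardᶜ.card ≤ f
  · rw [advance_of_le h]; exact Set.subset_insert _ _
  · rw [advance_of_not_le h]

theorem cur_advance (f : ℕ) (s : SimState n α) :
    (s.advance f).cur = s.cur ∨ (s.advance f).cur = s.nextView := by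
  by_cases h : s.heardᶜ.card ≤ f
  · right; rw [advance_of_le h]
  · left; rw [advance_of_not_le h]

/-- The properties of the simulation state of process `i` that do not depend on the run. -/
structure Valid (f : ℕ) (i : Fin n) (s : SimState n α) : Prop where
  owner_cur : s.cur.owner = i
  cur_mem : s.cur ∈ s.known
  -- Views of past rounds are kept, so that a process running ahead still serves the slower ones.
  exists_known : ∀ r ≤ s.cur.len, ∃ w ∈ s.known, w.owner = i ∧ w.len = r
  round_cur : ∀ v H m, s.cur = HOView.round v H m → i ∈ H ∧ Hᶜ.card ≤ f

theorem Valid.union {f : ℕ} {i : Fin n} {s : SimState n α} (hs : s.Valid f i)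
    (K : Set (HOView n α)) : Valid f i ⟨s.cur, s.known ∪ K⟩ where
  owner_cur := hs.owner_cur
  cur_mem := Or.inl hs.cur_mem
  exists_known r hr := by
    obtain ⟨w, hw, h⟩ := hs.exists_known r hr
    exact ⟨w, Or.inl hw, h⟩
  round_cur := hs.round_cur

theorem Valid.advance {f : ℕ} {i : Fin n} {s : SimState n α} (hs : s.Valid f i) :
    (s.advance f).Valid f i := by
  by_cases h : s.heardᶜ.card ≤ f
  · rw [advance_of_le h]
    refine ⟨hs.owner_cur, Set.mem_insert _ _, ?_, ?_⟩
    · intro r hr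
      rcases Nat.lt_or_ge s.cur.len r with hlt | hle
      · exact ⟨s.nextView, Set.mem_insert _ _, hs.owner_cur, le_antisymm hlt hr⟩
      · obtain ⟨w, hw, hw'⟩ := hs.exists_known r hle
        exact ⟨w, Set.mem_insert_of_mem _ hw, hw'⟩
    · intro v H m hv
      simp only [nextView, HOView.round.injEq] at hv
      obtain ⟨-, rfl, -⟩ := hv
      exact ⟨mem_heard.2 ⟨s.cur, hs.cur_mem, hs.owner_cur, rfl⟩, h⟩
  · rw [advance_of_not_le h]
    exact hs

end SimState

/-- The simulation state determined by an asynchronous view. -/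
noncomputable def simulate (f : ℕ) : AMPView n α → SimState n α
  | .start i x => ⟨.start i x, {.start i x}⟩
  | .recvNone v => (simulate f v).advance f
  | .recvMsg v m =>
    SimState.advance f ⟨(simulate f v).cur, (simulate f v).known ∪ (simulate f m).known⟩

/-- The simulated views known to the sender of a message, if there is a message. -/
def messageKnown (f : ℕ) (m : Option (AMPView n α)) : Set (HOView n α) :=
  {w | ∃ m', m = some m' ∧ w ∈ (simulate f m').known}

theorem simulate_receive (f : ℕ) (v : AMPView n α) (m : Option (AMPView n α)) :
    simulate f (v.receive m) =
      SimState.advance f ⟨(simulate f v).cur, (simulate f v).known ∪ messageKnown f m⟩ := by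
  cases m <;> simp [AMPView.receive, simulate, messageKnown]

/-- An asynchronous step simulates zero or one round. This holds for arbitrary views, not only those
arising in runs, as `decide_next` of the simulating protocol demands. -/
theorem cur_simulate_receive (f : ℕ) (v : AMPView n α) (m : Option (AMPView n α)) :
    (simulate f (v.receive m)).cur = (simulate f v).cur ∨
      ∃ H g, (simulate f (v.receive m)).cur = HOView.round (simulate f v).cur H g := by
  rw [simulate_receive]
  rcases SimState.cur_advance f
    ⟨(simulate f v).cur, (simulate f v).known ∪ messageKnown f m⟩ with h | h
  · exact Or.inl h
  · exact Or.inr ⟨_, _, h⟩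

/-- The simulation state of process `i` at time `t`. -/
noncomputable def simState (f : ℕ) (S : AMPSchedule n) (x : Fin n → α) (t : ℕ) (i : Fin n) :
    SimState n α :=
  simulate f ((ampConfig S x t).view i)

/-! ### Invariants of the simulation along a run -/

section Run

variable (f : ℕ) (S : AMPSchedule n) (x : Fin n → α)

theorem simState_succ_cases (t : ℕ) (i : Fin n) :
    (¬ S.StepsAt i t ∧ simState f S x (t + 1) i = simState f S x t i) ∨
      ∃ r, S.step t = some (i, r) ∧ simState f S x (t + 1) i =
        SimState.advance f ⟨(simState f S x t i).cur,
          (simState f S x t i).known ∪ messageKnown f (r.bind (ampConfig S x t).sent)⟩ := by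
  rcases ampConfig_view_cases S x t i with ⟨hn, h⟩ | ⟨r, hr, h⟩
  · left; exact ⟨hn, by rw [simState, h, simState]⟩
  · right; exact ⟨r, hr, by rw [simState, h, simulate_receive]; rfl⟩

theorem simState_valid (t : ℕ) (i : Fin n) : (simState f S x t i).Valid f i := by
  induction t with
  | zero =>
    refine ⟨rfl, Set.mem_singleton _, ?_, ?_⟩
    · intro r hr
      exact ⟨_, Set.mem_singleton _, rfl, (Nat.le_zero.1 hr).symm⟩
    · intro v H m h
      cases h
  | succ t ih =>
    rcases simState_succ_cases f S x t i with ⟨-, h⟩ | ⟨r, -, h⟩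
    · rw [h]; exact ih
    · rw [h]; exact (ih.union _).advance

theorem cur_simState_succ (t : ℕ) (i : Fin n) :
    (simState f S x (t + 1) i).cur = (simState f S x t i).cur ∨
      (simState f S x (t + 1) i).cur.len = (simState f S x t i).cur.len + 1 := by
  rcases simState_succ_cases f S x t i with ⟨-, h⟩ | ⟨r, -, h⟩
  · left; rw [h]
  · rw [h]
    refine (SimState.cur_advance f _).imp id fun h => ?_
    rw [h]; rfl

theorem len_simState_mono (i : Fin n) : Monotone fun t => (simState f S x t i).cur.len := by
  refine monotone_nat_of_le_succ fun t => ?_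
  rcases cur_simState_succ f S x t i with h | h
  · rw [h]
  · omega

theorem known_simState_mono (i : Fin n) : Monotone fun t => (simState f S x t i).known := by
  refine monotone_nat_of_le_succ fun t => ?_
  rcases simState_succ_cases f S x t i with ⟨-, h⟩ | ⟨r, -, h⟩
  · rw [h]
  · rw [h]
    exact fun w hw => SimState.known_subset_advance f _ (Or.inl hw)

/-- Each change of the current view raises its length by one, so the length determines it. Hence the
heard set of a completed round is unique and the choice in `simSchedule` is unambiguous. -/
theorem cur_simState_eq_of_len_eq (i : Fin n) {t t' : ℕ}
    (h : (simState f S x t i).cur.len = (simState f S x t' i).cur.len) :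
    (simState f S x t i).cur = (simState f S x t' i).cur := by
  have key : ∀ {a b : ℕ}, a ≤ b → (simState f S x a i).cur.len = (simState f S x b i).cur.len →
      (simState f S x a i).cur = (simState f S x b i).cur := by
    intro a b hab
    induction b, hab using Nat.le_induction with
    | base => intro _; rfl
    | succ b hab ih =>
      intro hl
      have hm : (simState f S x a i).cur.len ≤ (simState f S x b i).cur.len :=
        len_simState_mono f S x i hab
      rcases cur_simState_succ f S x b i with h | h
      · rw [h] at hl ⊢; exact ih hl
      · omega
  rcases le_total t t' with hle | hle
  · exact key hle h
  · exact (key hle h.symm).symm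

/-! ### Safety: the simulated run is a Heard-Of run -/

open Classical in
/-- The Heard-Of schedule simulated in an asynchronous run. Rounds that a process does not
complete are filled up with rounds in which it hears of all processes. -/
noncomputable def simSchedule : HOSchedule n where
  heard r i :=
    if h : ∃ H, ∃ t v m, (simState f S x t i).cur = HOView.round v H m ∧ v.len = r then h.choose
    else Finset.univ

theorem simSchedule_heard_eq {t : ℕ} {i : Fin n} {v : HOView n α} {H : Finset (Fin n)}
    {m : {j // j ∈ H} → HOView n α} (h : (simState f S x t i).cur = HOView.round v H m) :
    (simSchedule f S x).heard v.len i = H := by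
  have hex : ∃ H, ∃ t w m, (simState f S x t i).cur = HOView.round w H m ∧ w.len = v.len :=
    ⟨H, t, v, m, h, rfl⟩
  obtain ⟨t', w, m', hc, hw⟩ := hex.choose_spec
  have heq := cur_simState_eq_of_len_eq f S x i (t := t') (t' := t)
    (by rw [hc, h]; simp [HOView.len, hw])
  rw [hc, h] at heq
  simp only [HOView.round.injEq] at heq
  exact (dif_pos hex).trans heq.2.1

theorem simSchedule_admissible : (simSchedule f S x).Admissible f := by
  have key : ∀ r i, i ∈ (simSchedule f S x).heard r i ∧
      ((simSchedule f S x).heard r i)ᶜ.card ≤ f := by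
    intro r i
    by_cases hex : ∃ H, ∃ t v m, (simState f S x t i).cur = HOView.round v H m ∧ v.len = r
    · obtain ⟨H, t, v, m, hc, rfl⟩ := hex
      rw [simSchedule_heard_eq f S x hc]
      exact (simState_valid f S x t i).round_cur v H m hc
    · rw [show (simSchedule f S x).heard r i = Finset.univ from dif_neg hex]
      simp
  exact ⟨fun r i => (key r i).1, fun r i => (key r i).2⟩

/-- A known view was known before, or came in a message and so was known to the sender at an earlier
time, or is the result of the round just completed. Strong induction covers the first two cases; the
third holds because `simSchedule` records exactly the heard set of that round. -/
theorem known_simState_eq_hoView (t : ℕ) :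
    ∀ i, ∀ w ∈ (simState f S x t i).known, w = hoView (simSchedule f S x) x w.len w.owner := by
  induction t using Nat.strong_induction_on with
  | _ t ih =>
    cases t with
    | zero =>
      intro i w hw
      obtain rfl : w = HOView.start i (x i) := hw
      rfl
    | succ t =>
      intro i w hw
      rcases simState_succ_cases f S x t i with ⟨-, h⟩ | ⟨r, hr, h⟩
      · rw [h] at hw; exact ih t (Nat.lt_succ_self t) i w hw
      · generalize hs : (⟨(simState f S x t i).cur, (simState f S x t i).known ∪
          messageKnown f (r.bind (ampConfig S x t).sent)⟩ : SimState n α) = s at h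
        have hcur : s.cur = (simState f S x t i).cur := by rw [← hs]
        have hknown : ∀ w ∈ s.known,
            w = hoView (simSchedule f S x) x w.len w.owner := by
          intro w hw
          rw [← hs] at hw
          rcases hw with hw | ⟨m, hm, hw⟩
          · exact ih t (Nat.lt_succ_self t) i w hw
          · obtain ⟨q, -, hq⟩ := Option.bind_eq_some_iff.1 hm
            obtain ⟨hlt, j, rfl⟩ := ampConfig_sent S x t q m hq
            exact ih (q + 1) (by omega) j w hw
        by_cases hf : s.heardᶜ.card ≤ f
        · rw [SimState.advance_of_le hf] at h
          rw [h] at hw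
          rcases hw with rfl | hw
          · have hc : s.cur = hoView (simSchedule f S x) x s.cur.len i := by
              have h1 := hknown s.cur (by
                rw [← hs]; exact Or.inl (simState_valid f S x t i).cur_mem)
              rwa [hcur, (simState_valid f S x t i).owner_cur, ← hcur] at h1
            -- The schedule is defined from the whole run, so it already accounts for the round
            -- completed at this very step.
            have hH : (simSchedule f S x).heard s.cur.len i = s.heard :=
              simSchedule_heard_eq f S x (t := t + 1) (m := s.message) (by rw [h]; rfl)
            have ho : s.nextView.owner = i := by
              change s.cur.owner = i
              rw [hcur]; exact (simState_valid f S x t i).owner_cur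
            rw [ho]
            change HOView.round s.cur s.heard s.message =
              HOView.round (hoView (simSchedule f S x) x s.cur.len i)
                ((simSchedule f S x).heard s.cur.len i)
                (fun j => hoView (simSchedule f S x) x s.cur.len j.1)
            rw [hH, ← hc]
            congr 1
            funext j
            obtain ⟨h1, h2, h3⟩ := s.message_spec j
            have h4 := hknown _ h1
            rwa [h2, h3] at h4
          · exact hknown w hw
        · rw [SimState.advance_of_not_le hf] at h
          rw [h] at hw
          exact hknown w hw

theorem cur_simState_eq_hoView (t : ℕ) (i : Fin n) :
    (simState f S x t i).cur =
      hoView (simSchedule f S x) x (simState f S x t i).cur.len i := by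
  have h := known_simState_eq_hoView f S x t i _ (simState_valid f S x t i).cur_mem
  rwa [(simState_valid f S x t i).owner_cur] at h

/-! ### Liveness: non-faulty processes complete every round -/

variable {f S}

theorem exists_known_of_nonfaulty (hS : S.Admissible f) {i j : Fin n} (hi : ¬ S.Faulty i)
    (hj : ¬ S.Faulty j) {r t : ℕ} (hr : r ≤ (simState f S x t j).cur.len) :
    ∃ t', ∃ w ∈ (simState f S x t' i).known, w.owner = j ∧ w.len = r := by
  -- A non-faulty `j` broadcasts again after `t`, and that message carries all its simulated views
  -- up to round `r`.
  obtain ⟨s, hs, hts⟩ := Set.Infinite.exists_gt hj t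
  obtain ⟨t', ht'⟩ := hS.nonfaulty_liveness j i hj hi s hs
  have hst := (hS.integrity i t' s ht').1
  have hlen : r ≤ (simState f S x (s + 1) j).cur.len :=
    hr.trans (len_simState_mono f S x j (by omega))
  obtain ⟨w, hw, hw'⟩ := (simState_valid f S x (s + 1) j).exists_known r hlen
  refine ⟨t' + 1, w, ?_, hw'⟩
  rcases simState_succ_cases f S x t' i with ⟨hn, -⟩ | ⟨q, hq, h⟩
  · exact absurd ⟨_, ht'⟩ hn
  · obtain rfl : some s = q := by
      have := ht'.symm.trans hq
      simpa using this
    rw [h]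
    refine SimState.known_subset_advance f _ (Or.inr ?_)
    exact ⟨_, ampConfig_sent_of_stepsAt x hs hst, hw⟩

/-- Induction on rounds: once all non-faulty processes reach round `r`, their round-`r` views all
become known to `i`. If `i` were still in round `r`, its next step would find at most `f` views
missing and complete the round. -/
theorem exists_le_len_of_nonfaulty (hS : S.Admissible f) (r : ℕ) :
    ∀ i, ¬ S.Faulty i → ∃ t, r ≤ (simState f S x t i).cur.len := by
  classical
  induction r with
  | zero => exact fun i _ => ⟨0, Nat.zero_le _⟩
  | succ r ih =>
    intro i hi
    by_contra! hlt
    obtain ⟨t₀, ht₀⟩ := ih i hi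
    -- The time is chosen for faulty `j` too (as 0), so that `T` is total and has a supremum over
    -- all processes.
    have hex : ∀ j, ∃ t', ¬ S.Faulty j →
        ∃ w ∈ (simState f S x t' i).known, w.owner = j ∧ w.len = r := by
      intro j
      by_cases hj : S.Faulty j
      · exact ⟨0, fun h => absurd hj h⟩
      · obtain ⟨t, ht⟩ := ih j hj
        obtain ⟨t', h⟩ := exists_known_of_nonfaulty x hS hi hj ht
        exact ⟨t', fun _ => h⟩
    choose T hT using hex
    obtain ⟨t, ht, hmax⟩ := Set.Infinite.exists_gt hi (max t₀ (Finset.univ.sup T))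
    have hlen : (simState f S x t i).cur.len = r :=
      le_antisymm (Nat.le_of_lt_succ (hlt t))
        (ht₀.trans (len_simState_mono f S x i (by omega)))
    rcases simState_succ_cases f S x t i with ⟨hn, -⟩ | ⟨q, -, h⟩
    · exact hn ht
    · generalize hs : (⟨(simState f S x t i).cur, (simState f S x t i).known ∪
        messageKnown f (q.bind (ampConfig S x t).sent)⟩ : SimState n α) = s at h
      have hcur : s.cur.len = r := by rw [← hs]; exact hlen
      -- Step `t` comes after every `T j`, so only faulty processes can be unheard.
      have hsub : (s.heardᶜ : Finset (Fin n)) ⊆ Finset.univ.filter fun j => S.Faulty j := by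
        intro j hj
        rw [Finset.mem_filter]
        refine ⟨Finset.mem_univ j, ?_⟩
        by_contra hjf
        refine Finset.mem_compl.1 hj (SimState.mem_heard.2 ?_)
        obtain ⟨w, hw, ho, hl⟩ := hT j hjf
        have hTt : T j ≤ t := by
          have := Finset.le_sup (f := T) (Finset.mem_univ j)
          omega
        refine ⟨w, ?_, ho, hl.trans hcur.symm⟩
        rw [← hs]
        exact Or.inl (known_simState_mono f S x i hTt hw)
      have hcard : s.heardᶜ.card ≤ f := by
        refine (Finset.card_le_card hsub).trans (le_trans (le_of_eq ?_) hS.faulty_le)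
        rw [← Set.ncard_coe_finset]
        simp
      rw [SimState.advance_of_le hcard] at h
      have h1 := hlt (t + 1)
      rw [h] at h1
      change s.cur.len + 1 < r + 1 at h1
      omega

end Run

/-! ### The simulating protocol -/

/-- The asynchronous protocol that decides as the given protocol does on the simulated view. -/
noncomputable def Protocol.simulation {β : Type v} {f : ℕ} (P : Protocol (HO n f α) β) :
    Protocol (AMP n f α) β where
  decide i v := P.decide i (simulate f v).cur
  decide_next := by
    rintro i v _ o ⟨m, rfl⟩ h
    rcases cur_simulate_receive f v m with h' | ⟨H, g, h'⟩
    · exact (congrArg (P.decide i) h').trans h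
    · exact P.decide_next i _ _ o ⟨H, g, h'⟩ h

theorem Protocol.Solves.simulation {β : Type v} {f : ℕ} {P : Protocol (HO n f α) β}
    {T : Task n α β} (hP : P.Solves T) : P.simulation.Solves T := by
  intro x hx (S : AMPSchedule n) (hS : S.Admissible f)
  obtain ⟨hrel, hdec⟩ := hP x hx (simSchedule f S x) (simSchedule_admissible f S x)
  constructor
  -- A process that stops before the deciding round outputs `⊥` where the Heard-Of run may have a
  -- value.
  · refine T.rel_erase x _ _ hrel fun i => ?_
    rcases ho : P.simulation.output S x i with _ | o
    · exact Or.inr rfl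
    · left
      obtain ⟨t, ht⟩ := (P.simulation.output_eq_some_iff S x i o).1 ho
      refine ((P.output_eq_some_iff (simSchedule f S x) x i o).2
        ⟨(simState f S x t i).cur.len, ?_⟩).symm
      exact (congrArg (P.decide i) (cur_simState_eq_hoView f S x t i)).symm.trans ht
  · intro i hi
    by_contra hf
    rcases ho : P.output (simSchedule f S x) x i with _ | o
    · exact hdec i ho
    · obtain ⟨r, hr⟩ := (P.output_eq_some_iff _ x i o).1 ho
      obtain ⟨t, ht⟩ := exists_le_len_of_nonfaulty x hS r i hf
      -- At time `t` the simulation may already be past round `r`; the decision persists.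
      have h1 := P.decide_mono (simSchedule f S x) x i o ht hr
      have h2 : P.simulation.output S x i = some o :=
        (P.simulation.output_eq_some_iff S x i o).2
          ⟨t, (congrArg (P.decide i) (cur_simState_eq_hoView f S x t i)).trans h1⟩
      rw [hi] at h2
      cases h2

end TaskSolvability

theorem mainTheorem7 (n f : ℕ) (hf : f ≤ n) {α : Type*} {β : Type*}
    (T : TaskSolvability.Task n α β)
    (hT : T.Solvable (TaskSolvability.HO n f α)) :
    T.Solvable (TaskSolvability.AMP n f α) := by
  obtain ⟨P, hP⟩ := hT
  exact ⟨P.simulation, hP.simulation⟩
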